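/- Let $r\ge 1$ be an integer. There exist constants $A_r,B_r,C_r\in(0,\infty)$, depending only on $r$, such that the following holds. Let $(\Omega,\mathcal F,\mathbb P)$ be a probability space, $(S,\mathcal S)$ a measurable space, $h\colon S^r\to\mathbb R$ a measurable function ($S^r$ carrying the product $\sigma$-algebra; $h$ is not assumed symmetric), and $(X_i)_{i\ge 1}$ an i.i.d. sequence of $S$-valued random variables on $\Omega$. Suppose that $h$ is completely degenerate: for every $q\in\{1,\dots,r\}$ and all points $s_j\in S$, $j\in\{1,\dots,r\}\setminus\{q\}$, the random variable $h(s_1,\dots,s_{q-1},X_1,s_{q+1},\dots,s_r)$ is integrable and has expectation $0$. For $n\ge r$ put $$U_n:=\sum_{1\le i_1<\dots<i_r\le n}h(X_{i_1},\dots,X_{i_r}).$$ Then for all $x>0$, all $y>0$ with $x/y>3^r$, and all integers $n_2>n_1\ge r$, $$\mathbb P\left\{\frac{1}{\sqrt{n_2-n_1}\,n_2^{(r-1)/2}}\,|U_{n_2}-U_{n_1}|>x\right\}\le A_r\exp\left(-\frac12\left(\frac xy\right)^{2/r}\right)+B_r\int_1^{+\infty}\mathbb P\left\{|h(X_1,\dots,X_r)|>y\,u^{1/2}\,C_r\right\}(1+\ln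 u)^{q_r}\,\mathrm du,$$ where $q_r=r(r-1)/2$ and the right-hand side may be $+\infty$. -/

import Mathlib

open MeasureTheory ProbabilityTheory

namespace UStatistic

open Classical in
/-- The set of strictly increasing `r`-tuples of indices among the first `n` indices.
Sequences are indexed from `0`: the entry `X k` of a sequence `X` is what is usually
written `X_{k+1}`, so `i_1 < ... < i_r` range over `{0, ..., n-1}`. -/
noncomputable def indexSet (r n : ℕ) : Finset (Fin r → ℕ) :=
  (Fintype.piFinset fun _ : Fin r => Finset.range n).filter StrictMono

/-- The (non-normalized) `U`-statistic of order `r` with kernel `h` computed from the first `n`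
terms of the data `X`; no symmetry of `h` is required. -/
noncomputable def U {Ω S : Type*} {r : ℕ} (h : (Fin r → S) → ℝ) (X : ℕ → Ω → S)
    (n : ℕ) (ω : Ω) : ℝ :=
  ∑ i ∈ indexSet r n, h fun k => X (i k) ω

/-- Complete degeneracy of the kernel `h` with respect to the law of `Z`: freezing all the
arguments but one at arbitrary points and putting `Z` into the remaining one gives an
integrable random variable with expectation zero. (The value `s q` is not used.) -/
def IsCompletelyDegenerate {Ω S : Type*} [MeasurableSpace Ω] {r : ℕ}
    (h : (Fin r → S) → ℝ) (Z : Ω → S) (μ : Measure Ω) : Prop :=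
  ∀ (q : Fin r) (s : Fin r → S),
    Integrable (fun ω => h (Function.update s q (Z ω))) μ ∧
      ∫ ω, h (Function.update s q (Z ω)) ∂μ = 0

end UStatistic

namespace UStatistic

open scoped ENNReal


theorem exp_sub_self_le_exp_sq {s : ℝ} (hs : 0 ≤ s) : Real.exp s - s ≤ Real.exp (s ^ 2) := by
  rcases le_total s 1 with h | h
  · have h1 := Real.abs_exp_sub_one_sub_id_le (x := s) (by rwa [abs_of_nonneg hs])
    have h2 := Real.add_one_le_exp (s ^ 2)
    linarith [le_abs_self (Real.exp s - 1 - s)]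
  · have : Real.exp s ≤ Real.exp (s ^ 2) := Real.exp_le_exp.2 (by nlinarith)
    linarith

theorem exp_four_mul_le {v : ℝ} (h0 : 0 ≤ v) (h1 : v ≤ 1) : Real.exp (4 * v) ≤ 1 + 64 * v := by
  have hc := convexOn_exp.2 (Set.mem_univ (0 : ℝ)) (Set.mem_univ (4 : ℝ))
    (sub_nonneg.2 h1) h0 (by ring)
  simp only [smul_eq_mul, mul_zero, zero_add, Real.exp_zero, mul_one] at hc
  have he : Real.exp 4 ≤ 64 := by
    have h3 : Real.exp 4 = Real.exp 1 ^ 4 := by rw [← Real.exp_nat_mul]; norm_num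
    have h4 : Real.exp 1 ≤ 2.7182818286 := Real.exp_one_lt_d9.le
    rw [h3]
    calc Real.exp 1 ^ 4 ≤ 2.7182818286 ^ 4 := by gcongr
      _ ≤ 64 := by norm_num
  rw [mul_comm 4 v]
  nlinarith

theorem one_add_pow_sub_le {m : ℕ} (hm : 1 ≤ m) {t : ℝ} (ht : 0 ≤ t) :
    (1 + t) ^ (2 * m) - 2 * m * t ≤ (1 + 64 * m * t ^ 2) ^ m := by
  have hm' : (1 : ℝ) ≤ m := by exact_mod_cast hm
  rcases le_total (m * t ^ 2) 1 with h | h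
  · have h1 : (1 + t) ^ (2 * m) ≤ Real.exp (2 * m * t) := by
      calc (1 + t) ^ (2 * m) ≤ Real.exp t ^ (2 * m) := by
            gcongr
            linarith [Real.add_one_le_exp t]
        _ = _ := by rw [← Real.exp_nat_mul]; push_cast; ring_nf
    have h2 := exp_sub_self_le_exp_sq (s := 2 * m * t) (by positivity)
    have h3 : Real.exp ((2 * m * t) ^ 2) = Real.exp (4 * (m * t ^ 2)) ^ m := by
      rw [← Real.exp_nat_mul]; ring_nf
    have h4 : Real.exp (4 * (m * t ^ 2)) ^ m ≤ (1 + 64 * (m * t ^ 2)) ^ m := by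
      gcongr
      exact exp_four_mul_le (by positivity) h
    have h5 : (64 : ℝ) * (m * t ^ 2) = 64 * m * t ^ 2 := by ring
    rw [h5] at h4
    linarith
  · have h1 : (1 + t) ^ 2 ≤ 1 + 64 * m * t ^ 2 := by
      have : t ≤ m * t ^ 2 := by
        by_contra hlt
        push Not at hlt
        have : t * (1 - m * t) > 0 := by nlinarith
        have h5 : m * t < 1 := by
          by_contra h6
          push Not at h6
          nlinarith
        have h7 : (m * t) * t ≤ 1 * t := by gcongr
        have h8 : t ≤ m * t := le_mul_of_one_le_left ht hm'
        nlinarith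
      nlinarith [sq_nonneg t]
    have h2 : (1 + t) ^ (2 * m) ≤ (1 + 64 * m * t ^ 2) ^ m := by
      rw [pow_mul]; gcongr
    have : 0 ≤ 2 * m * t := by positivity
    linarith

theorem add_pow_sub_le {m : ℕ} (hm : 1 ≤ m) {a b : ℝ} (ha : 0 < a) (hb : 0 ≤ b) :
    (a + b) ^ (2 * m) - 2 * m * (a ^ (2 * m - 1) * b) ≤ (a ^ 2 + 64 * m * b ^ 2) ^ m := by
  have h := one_add_pow_sub_le hm (div_nonneg hb ha.le)
  have h2 := mul_le_mul_of_nonneg_left h (pow_nonneg ha.le (2 * m))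
  have e1 : a ^ (2 * m) * ((1 + b / a) ^ (2 * m) - 2 * m * (b / a)) =
      (a + b) ^ (2 * m) - 2 * m * (a ^ (2 * m - 1) * b) := by
    rw [mul_sub, ← mul_pow]
    congr 1
    · congr 1; field_simp
    · have : a ^ (2 * m) = a ^ (2 * m - 1) * a := by
        rw [← pow_succ]; congr 1; omega
      rw [this]; field_simp
  have e2 : a ^ (2 * m) * (1 + 64 * m * (b / a) ^ 2) ^ m = (a ^ 2 + 64 * m * b ^ 2) ^ m := by
    rw [pow_mul, ← mul_pow]; congr 1; field_simp
  rwa [e1, e2] at h2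

theorem abs_pow_mul_pow_le {k l : ℕ} {a b : ℝ} (ha : 0 < a) (hb : 0 < b) (hk : 0 < k + l)
    (u v : ℝ) :
    |u ^ k * v ^ l| ≤ a ^ k * b ^ l *
      (k / (k + l : ℕ) * (|u| ^ (k + l) / a ^ (k + l)) +
        l / (k + l : ℕ) * (|v| ^ (k + l) / b ^ (k + l))) := by
  have hkl : (0 : ℝ) < (k + l : ℕ) := by exact_mod_cast hk
  have h := Real.geom_mean_le_arith_mean2_weighted (w₁ := k / (k + l : ℕ)) (w₂ := l / (k + l : ℕ))
    (p₁ := (|u| / a) ^ (k + l)) (p₂ := (|v| / b) ^ (k + l)) (by positivity) (by positivity)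
    (by positivity) (by positivity) (by rw [← add_div]; push_cast at hkl ⊢; field_simp)
  have aux : ∀ (c : ℝ) (j : ℕ), 0 ≤ c → (c ^ (k + l)) ^ ((j : ℝ) / (k + l : ℕ)) = c ^ j := by
    intro c j hc
    rw [← Real.rpow_natCast c (k + l), ← Real.rpow_mul hc, mul_div_cancel₀ _ hkl.ne',
      Real.rpow_natCast]
  rw [aux _ _ (by positivity), aux _ _ (by positivity)] at h
  have e : |u ^ k * v ^ l| = a ^ k * b ^ l * ((|u| / a) ^ k * (|v| / b) ^ l) := by
    rw [abs_mul, abs_pow, abs_pow, div_pow, div_pow]; field_simp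
  rw [e]
  simp only [div_pow] at h ⊢
  gcongr

section Moments

variable {Ω : Type*} [MeasurableSpace Ω] {μ : Measure Ω}

theorem integrable_pow_mul_pow {Y Z : Ω → ℝ} {p k l : ℕ} (hp : 0 < p) (hkl : k + l = p)
    (hY : Measurable Y) (hZ : Measurable Z)
    (iY : Integrable (fun ω => |Y ω| ^ p) μ) (iZ : Integrable (fun ω => |Z ω| ^ p) μ) :
    Integrable (fun ω => Y ω ^ k * Z ω ^ l) μ := by
  subst hkl
  refine Integrable.mono' ((((iY.div_const (1 ^ (k + l))).const_mul (k / (k + l : ℕ) : ℝ)).add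
    ((iZ.div_const (1 ^ (k + l))).const_mul (l / (k + l : ℕ) : ℝ))).const_mul (1 ^ k * 1 ^ l)) ((hY.pow_const _).mul (hZ.pow_const _)).aestronglyMeasurable
    (Filter.Eventually.of_forall fun ω => ?_)
  exact abs_pow_mul_pow_le one_pos one_pos hp (Y ω) (Z ω)

theorem integral_pow_mul_pow_le {Y Z : Ω → ℝ} {p k l : ℕ} (hp : 0 < p) (hkl : k + l = p)
    (hY : Measurable Y) (hZ : Measurable Z)
    (iY : Integrable (fun ω => |Y ω| ^ p) μ) (iZ : Integrable (fun ω => |Z ω| ^ p) μ)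
    {a b : ℝ} (ha : 0 < a) (hb : 0 < b) (hYa : ∫ ω, |Y ω| ^ p ∂μ ≤ a ^ p)
    (hZb : ∫ ω, |Z ω| ^ p ∂μ ≤ b ^ p) :
    ∫ ω, Y ω ^ k * Z ω ^ l ∂μ ≤ a ^ k * b ^ l := by
  have hi := integrable_pow_mul_pow hp hkl hY hZ iY iZ
  subst hkl
  have hpos : (0 : ℝ) < (k + l : ℕ) := by exact_mod_cast hp
  have i1 := (iY.div_const (a ^ (k + l))).const_mul (k / (k + l : ℕ) : ℝ)
  have i2 := (iZ.div_const (b ^ (k + l))).const_mul (l / (k + l : ℕ) : ℝ)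
  calc ∫ ω, Y ω ^ k * Z ω ^ l ∂μ ≤ ∫ ω, a ^ k * b ^ l *
      (k / (k + l : ℕ) * (|Y ω| ^ (k + l) / a ^ (k + l)) +
        l / (k + l : ℕ) * (|Z ω| ^ (k + l) / b ^ (k + l))) ∂μ :=
        integral_mono hi ((i1.add i2).const_mul _) fun ω =>
          (le_abs_self _).trans (abs_pow_mul_pow_le ha hb hp (Y ω) (Z ω))
    _ = a ^ k * b ^ l * (k / (k + l : ℕ) * ((∫ ω, |Y ω| ^ (k + l) ∂μ) / a ^ (k + l)) +
        l / (k + l : ℕ) * ((∫ ω, |Z ω| ^ (k + l) ∂μ) / b ^ (k + l))) := by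
        rw [integral_const_mul, integral_add i1 i2, integral_const_mul, integral_const_mul,
          integral_div, integral_div]
    _ ≤ a ^ k * b ^ l * (k / (k + l : ℕ) * 1 + l / (k + l : ℕ) * 1) := by
        gcongr
        · exact div_le_one_of_le₀ hYa (by positivity)
        · exact div_le_one_of_le₀ hZb (by positivity)
    _ = a ^ k * b ^ l := by
        push_cast at hpos ⊢
        field_simp

theorem integral_add_pow_le_of_pos {Y Z : Ω → ℝ} {m : ℕ} (hm : 1 ≤ m)
    (hY : Measurable Y) (hZ : Measurable Z)
    (iY : Integrable (fun ω => |Y ω| ^ (2 * m)) μ) (iZ : Integrable (fun ω => |Z ω| ^ (2 * m)) μ)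
    (hYZ : ∫ ω, Y ω ^ (2 * m - 1) * Z ω ∂μ = 0)
    {a b : ℝ} (ha : 0 < a) (hb : 0 < b) (hYa : ∫ ω, |Y ω| ^ (2 * m) ∂μ ≤ a ^ (2 * m))
    (hZb : ∫ ω, |Z ω| ^ (2 * m) ∂μ ≤ b ^ (2 * m)) :
    ∫ ω, |Y ω + Z ω| ^ (2 * m) ∂μ ≤ (a ^ 2 + 64 * m * b ^ 2) ^ m := by
  have hp : 0 < 2 * m := by omega
  refine le_trans ?_ (add_pow_sub_le hm ha hb.le)
  have hex : ∀ ω, |Y ω + Z ω| ^ (2 * m) = ∑ k ∈ Finset.range (2 * m + 1),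
      Y ω ^ k * Z ω ^ (2 * m - k) * (2 * m).choose k := fun ω => by
    rw [(even_two_mul m).pow_abs, add_pow]
  simp_rw [hex]
  have hint : ∀ k ∈ Finset.range (2 * m + 1), Integrable
      (fun ω => Y ω ^ k * Z ω ^ (2 * m - k)) μ := fun k hk =>
    integrable_pow_mul_pow hp (by have := Finset.mem_range.1 hk; omega) hY hZ iY iZ
  rw [integral_finsetSum _ fun k hk => (hint k hk).mul_const _]
  have hmem : 2 * m - 1 ∈ Finset.range (2 * m + 1) := Finset.mem_range.2 (by omega)
  have hone : 2 * m - (2 * m - 1) = 1 := by omega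
  have hch : ((2 * m).choose (2 * m - 1) : ℝ) = 2 * m := by
    rw [Nat.choose_symm (by omega : 1 ≤ 2 * m), Nat.choose_one_right]; push_cast; ring
  rw [add_pow, ← Finset.add_sum_erase _ _ hmem, ← Finset.add_sum_erase _ _ hmem]
  rw [hone, hch]
  simp only [pow_one, integral_mul_const, hYZ]
  have : ∑ k ∈ (Finset.range (2 * m + 1)).erase (2 * m - 1),
      (∫ ω, Y ω ^ k * Z ω ^ (2 * m - k) ∂μ) * ((2 * m).choose k : ℝ) ≤
      ∑ k ∈ (Finset.range (2 * m + 1)).erase (2 * m - 1),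
        a ^ k * b ^ (2 * m - k) * ((2 * m).choose k : ℝ) := by
    refine Finset.sum_le_sum fun k hk => ?_
    have hk' := Finset.mem_range.1 (Finset.mem_of_mem_erase hk)
    gcongr
    exact integral_pow_mul_pow_le hp (by omega) hY hZ iY iZ ha hb hYa hZb
  linarith

theorem integral_add_pow_le {Y Z : Ω → ℝ} {m : ℕ} (hm : 1 ≤ m)
    (hY : Measurable Y) (hZ : Measurable Z)
    (iY : Integrable (fun ω => |Y ω| ^ (2 * m)) μ) (iZ : Integrable (fun ω => |Z ω| ^ (2 * m)) μ)
    (hYZ : ∫ ω, Y ω ^ (2 * m - 1) * Z ω ∂μ = 0)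
    {a b : ℝ} (ha : 0 ≤ a) (hb : 0 ≤ b) (hYa : ∫ ω, |Y ω| ^ (2 * m) ∂μ ≤ a ^ (2 * m))
    (hZb : ∫ ω, |Z ω| ^ (2 * m) ∂μ ≤ b ^ (2 * m)) :
    ∫ ω, |Y ω + Z ω| ^ (2 * m) ∂μ ≤ (a ^ 2 + 64 * m * b ^ 2) ^ m := by
  have hlim : Filter.Tendsto (fun ε : ℝ => ((a + ε) ^ 2 + 64 * m * (b + ε) ^ 2) ^ m)
      (nhdsWithin 0 (Set.Ioi 0)) (nhds (((a + 0) ^ 2 + 64 * m * (b + 0) ^ 2) ^ m)) :=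
    (Continuous.tendsto (by fun_prop) 0).mono_left nhdsWithin_le_nhds
  simp only [add_zero] at hlim
  refine ge_of_tendsto hlim (eventually_nhdsWithin_of_forall fun ε hε => ?_)
  have hε' : 0 < ε := hε
  refine integral_add_pow_le_of_pos hm hY hZ iY iZ hYZ (by positivity) (by positivity)
    (hYa.trans ?_) (hZb.trans ?_)
  · gcongr; linarith
  · gcongr; linarith

theorem integrable_abs_add_pow {Y Z : Ω → ℝ} {p : ℕ}
    (hY : Measurable Y) (hZ : Measurable Z)
    (iY : Integrable (fun ω => |Y ω| ^ p) μ) (iZ : Integrable (fun ω => |Z ω| ^ p) μ) :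
    Integrable (fun ω => |Y ω + Z ω| ^ p) μ := by
  refine Integrable.mono' ((iY.add iZ).const_mul (2 ^ (p - 1)))
    (((hY.add hZ).abs).pow_const _).aestronglyMeasurable
    (Filter.Eventually.of_forall fun ω => ?_)
  rw [Real.norm_of_nonneg (by positivity)]
  calc |Y ω + Z ω| ^ p ≤ (|Y ω| + |Z ω|) ^ p := by gcongr; exact abs_add_le _ _
    _ ≤ _ := add_pow_le (abs_nonneg _) (abs_nonneg _) _

/-- Moment inequality for sums of random variables that are orthogonal to odd powers of
the preceding partial sums. -/
theorem integral_sum_pow_le {D : ℕ → Ω → ℝ} {m : ℕ} (hm : 1 ≤ m) {n₁ n₂ : ℕ} (hn : n₁ ≤ n₂)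
    (hD : ∀ i, Measurable (D i))
    (iD : ∀ i < n₂, Integrable (fun ω => |D i ω| ^ (2 * m)) μ)
    (horth : ∀ i, n₁ ≤ i → i < n₂ →
      ∫ ω, (∑ j ∈ Finset.Ico n₁ i, D j ω) ^ (2 * m - 1) * D i ω ∂μ = 0)
    {b : ℝ} (hb : 0 ≤ b) (hDb : ∀ i < n₂, ∫ ω, |D i ω| ^ (2 * m) ∂μ ≤ b ^ (2 * m)) :
    Integrable (fun ω => |∑ j ∈ Finset.Ico n₁ n₂, D j ω| ^ (2 * m)) μ ∧
    ∫ ω, |∑ j ∈ Finset.Ico n₁ n₂, D j ω| ^ (2 * m) ∂μ ≤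
      (64 * m * ((n₂ - n₁ : ℕ) : ℝ) * b ^ 2) ^ m := by
  induction n₂, hn using Nat.le_induction with
  | base => simp [show 2 * m ≠ 0 by omega, show m ≠ 0 by omega]
  | succ n hn ih =>
    obtain ⟨ih1, ih2⟩ := ih (fun i hi => iD i (by omega)) (fun i h1 h2 => horth i h1 (by omega))
      (fun i hi => hDb i (by omega))
    have hS : Measurable fun ω => ∑ j ∈ Finset.Ico n₁ n, D j ω :=
      Finset.measurable_sum _ fun i _ => hD i
    simp only [Finset.sum_Ico_succ_top hn]
    refine ⟨integrable_abs_add_pow hS (hD n) ih1 (iD n (by omega)), ?_⟩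
    have := integral_add_pow_le hm hS (hD n) ih1 (iD n (by omega)) (horth n hn (by omega))
      (a := Real.sqrt (64 * m * ((n - n₁ : ℕ) : ℝ) * b ^ 2)) (by positivity) hb
      (by rw [pow_mul, Real.sq_sqrt (by positivity)]; exact ih2) (hDb n (by omega))
    refine this.trans (le_of_eq ?_)
    rw [Real.sq_sqrt (by positivity), Nat.succ_sub hn]
    push_cast
    ring

end Moments

theorem measurePreserving_update {ι S : Type*} [DecidableEq ι] [MeasurableSpace S]
    (ν : Measure S) [IsProbabilityMeasure ν] (i : ι) :
    MeasurePreserving (fun p : (ι → S) × S => Function.update p.1 i p.2)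
      ((Measure.infinitePi fun _ : ι => ν).prod ν) (Measure.infinitePi fun _ : ι => ν) where
  measurable := measurable_update'
  map_eq := by
    refine Measure.eq_infinitePi _ fun s t ht => ?_
    have hpre : (fun p : (ι → S) × S => Function.update p.1 i p.2) ⁻¹' (Set.pi s t) =
        (Set.pi (s.erase i : Finset ι) t) ×ˢ (if i ∈ s then t i else Set.univ) := by
      ext ⟨x, z⟩
      simp only [Set.mem_preimage, Set.mem_pi, Set.mem_prod, Finset.mem_coe, Finset.mem_erase]
      constructor
      · intro h
        refine ⟨fun j hj => by simpa [hj.1] using h j hj.2, ?_⟩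
        split_ifs with hi
        · simpa using h i hi
        · trivial
      · rintro ⟨h1, h2⟩ j hj
        by_cases hji : j = i
        · subst hji; simpa [hj] using h2
        · simpa [hji] using h1 j ⟨hji, hj⟩
    rw [Measure.map_apply measurable_update'
      (MeasurableSet.pi s.countable_toSet fun j _ => ht j), hpre, Measure.prod_prod,
      Measure.infinitePi_pi _ fun j _ => ht j]
    split_ifs with hi
    · rw [Finset.prod_erase_mul _ _ hi]
    · rw [measure_univ, mul_one, Finset.erase_eq_of_notMem hi]

section Recursion

variable {S : Type*} {r : ℕ}

/-- The kernel obtained from `h` by fixing the last argument. -/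
def fixLast (h : (Fin (r + 1) → S) → ℝ) (s : S) : (Fin r → S) → ℝ :=
  fun q => h (Fin.snoc (α := fun _ => S) q s)

/-- The `U`-statistic as a function of the data sequence. -/
noncomputable def coordU (h : (Fin r → S) → ℝ) (n : ℕ) (x : ℕ → S) : ℝ :=
  U h (fun i (x : ℕ → S) => x i) n x

/-- The first `r` terms of a sequence. -/
def head (r : ℕ) (x : ℕ → S) : Fin r → S := fun k => x k

theorem mem_indexSet {n : ℕ} {I : Fin r → ℕ} :
    I ∈ indexSet r n ↔ (∀ k, I k < n) ∧ StrictMono I := by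
  simp [indexSet]

theorem coordU_congr (h : (Fin r → S) → ℝ) {n : ℕ} {x x' : ℕ → S} (hx : ∀ i < n, x i = x' i) :
    coordU h n x = coordU h n x' := by
  refine Finset.sum_congr rfl fun I hI => ?_
  congr 1
  funext k
  exact hx _ ((mem_indexSet.1 hI).1 k)

theorem snoc_mem_indexSet {n i : ℕ} {J : Fin r → ℕ} :
    (Fin.snoc (α := fun _ => ℕ) J i : Fin (r + 1) → ℕ) ∈ indexSet (r + 1) n ↔
      i < n ∧ J ∈ indexSet r i := by
  simp only [mem_indexSet]
  constructor
  · rintro ⟨h1, h2⟩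
    refine ⟨by simpa using h1 (Fin.last r), fun k => ?_, fun k l hkl => ?_⟩
    · simpa using h2 (Fin.castSucc_lt_last k)
    · simpa using h2 (Fin.castSucc_lt_castSucc_iff.2 hkl)
  · rintro ⟨h1, h2, h3⟩
    refine ⟨fun k => ?_, fun k l hkl => ?_⟩
    · induction k using Fin.lastCases with
      | last => simpa using h1
      | cast k => simpa using (h2 k).trans h1
    · induction l using Fin.lastCases with
      | last =>
        obtain ⟨k, rfl⟩ := Fin.exists_castSucc_eq.2 hkl.ne
        simpa using h2 k
      | cast l =>
        obtain ⟨k, rfl⟩ := Fin.exists_castSucc_eq.2 (hkl.trans (Fin.castSucc_lt_last l)).ne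
        simpa using h3 (Fin.castSucc_lt_castSucc_iff.1 hkl)

theorem coordU_succ (h : (Fin (r + 1) → S) → ℝ) (n : ℕ) (x : ℕ → S) :
    coordU h n x = ∑ i ∈ Finset.range n, coordU (fixLast h (x i)) i x := by
  simp only [coordU, U, fixLast]
  rw [Finset.sum_sigma']
  symm
  refine Finset.sum_bij' (fun p _ => Fin.snoc (α := fun _ => ℕ) p.2 p.1)
    (fun I _ => ⟨I (Fin.last r), Fin.init I⟩) ?_ ?_ ?_ ?_ ?_
  · rintro ⟨i, J⟩ hp
    simp only [Finset.mem_sigma, Finset.mem_range] at hp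
    exact snoc_mem_indexSet.2 hp
  · intro I hI
    rw [← Fin.snoc_init_self I] at hI
    simpa using snoc_mem_indexSet.1 hI
  · rintro ⟨i, J⟩ hp
    simp
  · intro I hI
    simp
  · rintro ⟨i, J⟩ hp
    congr 1
    funext k
    induction k using Fin.lastCases with
    | last => simp
    | cast k => simp

theorem coordU_sub (h : (Fin (r + 1) → S) → ℝ) {n₁ n₂ : ℕ} (hn : n₁ ≤ n₂) (x : ℕ → S) :
    coordU h n₂ x - coordU h n₁ x = ∑ i ∈ Finset.Ico n₁ n₂, coordU (fixLast h (x i)) i x := by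
  rw [coordU_succ, coordU_succ, Finset.sum_Ico_eq_sub _ hn]

theorem coordU_zero (h : (Fin 0 → S) → ℝ) (n : ℕ) (x : ℕ → S) :
    coordU h n x = h (head 0 x) := by
  have : indexSet 0 n = {Fin.elim0} := by
    ext I
    simp only [mem_indexSet, Finset.mem_singleton]
    exact ⟨fun _ => Subsingleton.elim _ _, fun _ => ⟨fun k => k.elim0, fun k => k.elim0⟩⟩
  rw [coordU, U, this, Finset.sum_singleton]
  congr 1
  exact Subsingleton.elim _ _

theorem coordU_of_sub (g h : (Fin r → S) → ℝ) (n : ℕ) (x : ℕ → S) :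
    coordU (fun s => g s - h s) n x = coordU g n x - coordU h n x := by
  simp only [coordU, U, Finset.sum_sub_distrib]

theorem head_succ_update (x : ℕ → S) (z : S) :
    head (r + 1) (Function.update x r z) = Fin.snoc (α := fun _ => S) (head r x) z := by
  funext k
  induction k using Fin.lastCases with
  | last => simp [head]
  | cast k => simp [head, Function.update_of_ne k.isLt.ne]

theorem head_update (x : ℕ → S) (q : Fin r) (z : S) :
    head r (Function.update x q z) = Function.update (head r x) q z := by
  funext k
  by_cases hk : k = q
  · subst hk; simp [head]
  · rw [Function.update_of_ne hk, head, Function.update_of_ne (fun hh => hk (Fin.ext hh)), head]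

variable [MeasurableSpace S]

theorem measurable_snoc :
    Measurable fun p : (Fin r → S) × S => Fin.snoc (α := fun _ => S) p.1 p.2 := by
  refine measurable_pi_iff.2 fun k => ?_
  induction k using Fin.lastCases with
  | last => simpa using measurable_snd
  | cast k =>
    simp only [Fin.snoc_castSucc]
    exact (measurable_pi_apply k).comp measurable_fst

theorem measurable_fixLast {h : (Fin (r + 1) → S) → ℝ} (hh : Measurable h) (s : S) :
    Measurable (fixLast h s) :=
  hh.comp (measurable_snoc.comp (measurable_id.prodMk measurable_const))

theorem measurable_head : Measurable (head r : (ℕ → S) → Fin r → S) :=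
  measurable_pi_iff.2 fun _ => measurable_pi_apply _

theorem measurable_coordU {h : (Fin r → S) → ℝ} (hh : Measurable h) (n : ℕ) :
    Measurable (coordU h n) :=
  Finset.measurable_sum _ fun I _ =>
    hh.comp (measurable_pi_iff.2 fun k => measurable_pi_apply (I k))

theorem measurable_coordU_fixLast {h : (Fin (r + 1) → S) → ℝ} (hh : Measurable h) (n : ℕ) :
    Measurable fun p : (ℕ → S) × S => coordU (fixLast h p.2) n p.1 := by
  refine Finset.measurable_sum _ fun I _ => ?_
  have hI : Measurable fun p : (ℕ → S) × S => ((fun k => p.1 (I k) : Fin r → S), p.2) :=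
    Measurable.prodMk (measurable_pi_iff.2 fun k =>
      (measurable_pi_apply (I k)).comp measurable_fst) measurable_snd
  exact hh.comp (measurable_snoc.comp hI)

theorem IsCompletelyDegenerate.fixLast {ν : Measure S} {h : (Fin (r + 1) → S) → ℝ}
    (hd : IsCompletelyDegenerate h id ν) (s : S) :
    IsCompletelyDegenerate (UStatistic.fixLast h s) id ν := by
  intro q p
  have := hd q.castSucc (Fin.snoc (α := fun _ => S) p s)
  simp only [← Fin.snoc_update] at this
  exact this

theorem IsCompletelyDegenerate.sub {ν : Measure S} {h g : (Fin r → S) → ℝ}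
    (hh : IsCompletelyDegenerate h id ν) (hg : IsCompletelyDegenerate g id ν) :
    IsCompletelyDegenerate (fun s => h s - g s) id ν := fun q s =>
  ⟨(hh q s).1.sub (hg q s).1, by
    rw [integral_sub (hh q s).1 (hg q s).1, (hh q s).2, (hg q s).2, sub_zero]⟩

theorem integral_coordU_fixLast {ν : Measure S} {h : (Fin (r + 1) → S) → ℝ}
    (hd : IsCompletelyDegenerate h id ν) (n : ℕ) (x : ℕ → S) :
    ∫ z, coordU (fixLast h z) n x ∂ν = 0 := by
  have key : ∀ I : Fin r → ℕ,
      Integrable (fun z => h (Fin.snoc (α := fun _ => S) (fun k => x (I k)) z)) ν ∧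
        ∫ z, h (Fin.snoc (α := fun _ => S) (fun k => x (I k)) z) ∂ν = 0 := by
    intro I
    have := hd (Fin.last r) (Fin.snoc (α := fun _ => S) (fun k => x (I k)) (x 0))
    simp only [Fin.update_snoc_last] at this
    exact this
  simp only [coordU, U, UStatistic.fixLast]
  rw [integral_finsetSum _ fun I _ => (key I).1]
  exact Finset.sum_eq_zero fun I _ => (key I).2

end Recursion

theorem enorm_pow_eq_ofReal (a : ℝ) (p : ℕ) : ‖a‖ₑ ^ p = ENNReal.ofReal (|a| ^ p) := by
  rw [Real.enorm_eq_ofReal_abs, ENNReal.ofReal_pow (abs_nonneg _)]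

section MomentBound

variable {S : Type*} [MeasurableSpace S] {r : ℕ} (ν : Measure S) [IsProbabilityMeasure ν]

theorem lintegral_update {ι : Type*} [DecidableEq ι] (i : ι) {F : (ι → S) → ℝ≥0∞}
    (hF : Measurable F) :
    ∫⁻ x, F x ∂(Measure.infinitePi fun _ : ι => ν) =
      ∫⁻ x, ∫⁻ z, F (Function.update x i z) ∂ν ∂(Measure.infinitePi fun _ : ι => ν) := by
  rw [← (measurePreserving_update ν i).lintegral_comp hF]
  exact lintegral_prod _ (hF.comp measurable_update').aemeasurable

theorem lintegral_fixLast {h : (Fin (r + 1) → S) → ℝ} (hh : Measurable h) (p : ℕ) :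
    ∫⁻ z, ∫⁻ x, ‖fixLast h z (head r x)‖ₑ ^ p ∂(Measure.infinitePi fun _ : ℕ => ν) ∂ν =
      ∫⁻ x, ‖h (head (r + 1) x)‖ₑ ^ p ∂(Measure.infinitePi fun _ : ℕ => ν) := by
  have hm : Measurable fun x : ℕ → S => ‖h (head (r + 1) x)‖ₑ ^ p :=
    (hh.comp measurable_head).enorm.pow_const p
  rw [lintegral_update ν r hm]
  simp only [head_succ_update]
  rw [lintegral_lintegral_swap]
  · rfl
  · exact ((hh.comp (measurable_snoc.comp ((measurable_head.comp measurable_snd).prodMk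
      measurable_fst))).enorm.pow_const p).aemeasurable

theorem lintegral_coordU_last_le {m : ℕ}
    (ih : ∀ g : (Fin r → S) → ℝ, Measurable g → IsCompletelyDegenerate g id ν → ∀ n,
      ∫⁻ x, ‖coordU g n x‖ₑ ^ (2 * m) ∂(Measure.infinitePi fun _ : ℕ => ν) ≤
        ((64 * m * n : ℕ) : ℝ≥0∞) ^ (r * m) *
          ∫⁻ x, ‖g (head r x)‖ₑ ^ (2 * m) ∂(Measure.infinitePi fun _ : ℕ => ν))
    {h : (Fin (r + 1) → S) → ℝ} (hh : Measurable h) (hd : IsCompletelyDegenerate h id ν) (i : ℕ) :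
    ∫⁻ x, ‖coordU (fixLast h (x i)) i x‖ₑ ^ (2 * m) ∂(Measure.infinitePi fun _ : ℕ => ν) ≤
      ((64 * m * i : ℕ) : ℝ≥0∞) ^ (r * m) *
        ∫⁻ x, ‖h (head (r + 1) x)‖ₑ ^ (2 * m) ∂(Measure.infinitePi fun _ : ℕ => ν) := by
  have hm1 := measurable_coordU_fixLast hh i
  have hm2 : Measurable fun x : ℕ → S => ‖coordU (fixLast h (x i)) i x‖ₑ ^ (2 * m) :=
    (hm1.comp (measurable_id.prodMk (measurable_pi_apply i))).enorm.pow_const (2 * m)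
  rw [lintegral_update ν i hm2]
  have : ∀ (x : ℕ → S) (z : S), coordU (fixLast h (Function.update x i z i)) i
      (Function.update x i z) = coordU (fixLast h z) i x := fun x z => by
    rw [Function.update_self]
    exact coordU_congr _ fun j hj => Function.update_of_ne hj.ne _ _
  simp only [this]
  rw [lintegral_lintegral_swap (hm1.enorm.pow_const _).aemeasurable, ← lintegral_fixLast ν hh,
    ← lintegral_const_mul']
  · exact lintegral_mono fun z => ih _ (measurable_fixLast hh z) (hd.fixLast z) i
  · exact ENNReal.pow_ne_top (ENNReal.natCast_ne_top _)

theorem integral_pow_mul_coordU_last {h : (Fin (r + 1) → S) → ℝ}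
    (hd : IsCompletelyDegenerate h id ν) (n₁ i k : ℕ) :
    ∫ x, (∑ j ∈ Finset.Ico n₁ i, coordU (fixLast h (x j)) j x) ^ k *
      coordU (fixLast h (x i)) i x ∂(Measure.infinitePi fun _ : ℕ => ν) = 0 := by
  by_cases hint : Integrable (fun x : ℕ → S =>
      (∑ j ∈ Finset.Ico n₁ i, coordU (fixLast h (x j)) j x) ^ k *
      coordU (fixLast h (x i)) i x) (Measure.infinitePi fun _ : ℕ => ν)
  swap
  · exact integral_undef hint
  have mp := measurePreserving_update ν i
  have hint2 := mp.integrable_comp_of_integrable hint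
  rw [← mp.map_eq] at hint
  rw [← mp.map_eq, integral_map mp.measurable.aemeasurable hint.aestronglyMeasurable]
  refine (integral_prod _ hint2).trans ?_
  refine integral_eq_zero_of_ae (Filter.Eventually.of_forall fun x => ?_)
  have h1 : ∀ z, coordU (fixLast h (Function.update x i z i)) i
      (Function.update x i z) = coordU (fixLast h z) i x := fun z => by
    rw [Function.update_self]
    exact coordU_congr _ fun j hj => Function.update_of_ne hj.ne _ _
  have h2 : ∀ z, ∑ j ∈ Finset.Ico n₁ i, coordU (fixLast h (Function.update x i z j)) j
      (Function.update x i z) = ∑ j ∈ Finset.Ico n₁ i, coordU (fixLast h (x j)) j x := fun z => by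
    refine Finset.sum_congr rfl fun j hj => ?_
    have hj' := (Finset.mem_Ico.1 hj).2
    rw [Function.update_of_ne hj'.ne]
    exact coordU_congr _ fun l hl => Function.update_of_ne (hl.trans hj').ne _ _
  simp only [Function.comp_apply, h1, h2]
  rw [integral_const_mul, integral_coordU_fixLast hd, mul_zero, Pi.zero_apply]

theorem lintegral_coordU_sub_le_of {m : ℕ} (hm : 1 ≤ m)
    (ih : ∀ g : (Fin r → S) → ℝ, Measurable g → IsCompletelyDegenerate g id ν → ∀ n,
      ∫⁻ x, ‖coordU g n x‖ₑ ^ (2 * m) ∂(Measure.infinitePi fun _ : ℕ => ν) ≤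
        ((64 * m * n : ℕ) : ℝ≥0∞) ^ (r * m) *
          ∫⁻ x, ‖g (head r x)‖ₑ ^ (2 * m) ∂(Measure.infinitePi fun _ : ℕ => ν))
    {h : (Fin (r + 1) → S) → ℝ} (hh : Measurable h) (hd : IsCompletelyDegenerate h id ν)
    {n₁ n₂ : ℕ} (hn : n₁ ≤ n₂) :
    ∫⁻ x, ‖coordU h n₂ x - coordU h n₁ x‖ₑ ^ (2 * m) ∂(Measure.infinitePi fun _ : ℕ => ν) ≤
      ((64 * m * (n₂ - n₁) : ℕ) : ℝ≥0∞) ^ m * (((64 * m * n₂ : ℕ) : ℝ≥0∞) ^ (r * m) *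
        ∫⁻ x, ‖h (head (r + 1) x)‖ₑ ^ (2 * m) ∂(Measure.infinitePi fun _ : ℕ => ν)) := by
  rcases hn.eq_or_lt with rfl | hlt
  · simp [show m ≠ 0 by omega]
  set P := Measure.infinitePi fun _ : ℕ => ν
  set β := ((64 * m * n₂ : ℕ) : ℝ≥0∞) ^ (r * m) * ∫⁻ x, ‖h (head (r + 1) x)‖ₑ ^ (2 * m) ∂P
  by_cases hβ : β = ∞
  · rw [hβ, ENNReal.mul_top]
    · exact le_top
    · refine pow_ne_zero _ (Nat.cast_ne_zero.2 (Nat.mul_ne_zero (by omega) (by omega)))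
  have hDm : ∀ i, Measurable fun x : ℕ → S => coordU (fixLast h (x i)) i x := fun i =>
    (measurable_coordU_fixLast hh i).comp (measurable_id.prodMk (measurable_pi_apply i))
  have hDβ : ∀ i < n₂, ∫⁻ x, ENNReal.ofReal (|coordU (fixLast h (x i)) i x| ^ (2 * m)) ∂P ≤ β := by
    intro i hi
    simp only [← enorm_pow_eq_ofReal]
    refine (lintegral_coordU_last_le ν ih hh hd i).trans ?_
    have := hi.le
    simp only [β]
    gcongr
  have hDi : ∀ i < n₂, Integrable (fun x => |coordU (fixLast h (x i)) i x| ^ (2 * m)) P := by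
    intro i hi
    refine ⟨((hDm i).abs.pow_const _).aestronglyMeasurable, ?_⟩
    rw [hasFiniteIntegral_iff_ofReal (Filter.Eventually.of_forall fun x => by positivity)]
    exact (hDβ i hi).trans_lt (lt_top_iff_ne_top.2 hβ)
  have hm2 : (2 * m : ℕ) ≠ 0 := by omega
  have hb : (β.toReal ^ (((2 * m : ℕ) : ℝ)⁻¹)) ^ (2 * m) = β.toReal :=
    Real.rpow_inv_natCast_pow ENNReal.toReal_nonneg hm2
  obtain ⟨h1, h2⟩ := integral_sum_pow_le (μ := P) hm hn hDm hDi
    (fun i _ _ => integral_pow_mul_coordU_last ν hd n₁ i (2 * m - 1))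
    (b := β.toReal ^ (((2 * m : ℕ) : ℝ)⁻¹)) (by positivity) (fun i hi => by
      rw [hb, integral_eq_lintegral_of_nonneg_ae
        (Filter.Eventually.of_forall fun x => by positivity) (hDi i hi).aestronglyMeasurable]
      exact ENNReal.toReal_mono hβ (hDβ i hi))
  simp only [enorm_pow_eq_ofReal, coordU_sub h hn]
  rw [← ofReal_integral_eq_lintegral_ofReal h1
    (Filter.Eventually.of_forall fun x => by positivity)]
  refine (ENNReal.ofReal_le_ofReal h2).trans (le_of_eq ?_)
  rw [mul_pow, ← pow_mul, hb, ENNReal.ofReal_mul (by positivity), ENNReal.ofReal_toReal hβ,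
    ENNReal.ofReal_pow (by positivity)]
  congr 2
  rw [← ENNReal.ofReal_natCast]
  push_cast
  rfl

theorem lintegral_coordU_le {m : ℕ} (hm : 1 ≤ m) {r : ℕ} (h : (Fin r → S) → ℝ)
    (hh : Measurable h) (hd : IsCompletelyDegenerate h id ν) (n : ℕ) :
    ∫⁻ x, ‖coordU h n x‖ₑ ^ (2 * m) ∂(Measure.infinitePi fun _ : ℕ => ν) ≤
      ((64 * m * n : ℕ) : ℝ≥0∞) ^ (r * m) *
        ∫⁻ x, ‖h (head r x)‖ₑ ^ (2 * m) ∂(Measure.infinitePi fun _ : ℕ => ν) := by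
  induction r generalizing n with
  | zero => simp [coordU_zero]
  | succ r ih =>
    have h0 : ∀ x, coordU h 0 x = 0 := fun x => by rw [coordU_succ]; simp
    have := lintegral_coordU_sub_le_of ν hm ih hh hd (Nat.zero_le n)
    simp only [h0, sub_zero] at this
    refine this.trans (le_of_eq ?_)
    rw [Nat.sub_zero, ← mul_assoc, ← pow_add]
    congr 2
    ring

/-- Even moments of increments of completely degenerate `U`-statistics. -/
theorem lintegral_coordU_sub_le {m : ℕ} (hm : 1 ≤ m) {h : (Fin (r + 1) → S) → ℝ}
    (hh : Measurable h) (hd : IsCompletelyDegenerate h id ν) {n₁ n₂ : ℕ} (hn : n₁ ≤ n₂) :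
    ∫⁻ x, ‖coordU h n₂ x - coordU h n₁ x‖ₑ ^ (2 * m) ∂(Measure.infinitePi fun _ : ℕ => ν) ≤
      ((64 * m * (n₂ - n₁) : ℕ) : ℝ≥0∞) ^ m * (((64 * m * n₂ : ℕ) : ℝ≥0∞) ^ (r * m) *
        ∫⁻ x, ‖h (head (r + 1) x)‖ₑ ^ (2 * m) ∂(Measure.infinitePi fun _ : ℕ => ν)) :=
  lintegral_coordU_sub_le_of ν hm (lintegral_coordU_le ν hm) hh hd hn

end MomentBound

section Centering

variable {S : Type*} [MeasurableSpace S] {r : ℕ} (ν : Measure S) [IsProbabilityMeasure ν]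

/-- Centering of a kernel with respect to its `q`-th argument. -/
noncomputable def centerAt (q : Fin r) (g : (Fin r → S) → ℝ) : (Fin r → S) → ℝ :=
  fun s => g s - ∫ z, g (Function.update s q z) ∂ν

/-- Successive centering of a kernel with respect to the arguments in a list. -/
noncomputable def centerList (l : List (Fin r)) (g : (Fin r → S) → ℝ) : (Fin r → S) → ℝ :=
  l.foldr (centerAt ν) g

variable {ν}

theorem measurable_centerAt (q : Fin r) {g : (Fin r → S) → ℝ} (hg : Measurable g) :
    Measurable (centerAt ν q g) := by
  refine hg.sub ?_
  have : StronglyMeasurable fun p : (Fin r → S) × S => g (Function.update p.1 q p.2) :=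
    (hg.comp measurable_update').stronglyMeasurable
  exact this.integral_prod_right'.measurable

theorem measurable_centerList (l : List (Fin r)) {g : (Fin r → S) → ℝ} (hg : Measurable g) :
    Measurable (centerList ν l g) := by
  induction l with
  | nil => exact hg
  | cons q l ih => exact measurable_centerAt q ih

theorem abs_centerAt_le (q : Fin r) {g : (Fin r → S) → ℝ} {M : ℝ} (hM : ∀ s, |g s| ≤ M)
    (s : Fin r → S) : |centerAt ν q g s| ≤ 2 * M := by
  have h1 : |∫ z, g (Function.update s q z) ∂ν| ≤ M := by
    have := norm_integral_le_of_norm_le_const (μ := ν) (C := M)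
      (f := fun z => g (Function.update s q z)) (Filter.Eventually.of_forall fun z => hM (Function.update s q z))
    simpa using this
  rw [centerAt, two_mul]
  exact (abs_sub _ _).trans (add_le_add (hM s) h1)

theorem abs_centerList_le (l : List (Fin r)) {g : (Fin r → S) → ℝ} {M : ℝ} (hM : ∀ s, |g s| ≤ M)
    (s : Fin r → S) : |centerList ν l g s| ≤ 2 ^ l.length * M := by
  induction l generalizing s with
  | nil => simpa [centerList] using hM s
  | cons q l ih =>
    refine (abs_centerAt_le q ih s).trans (le_of_eq ?_)
    rw [List.length_cons, pow_succ]
    ring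

theorem integrable_update_of_bounded {g : (Fin r → S) → ℝ} (hg : Measurable g) {M : ℝ}
    (hM : ∀ s, |g s| ≤ M) (q : Fin r) (s : Fin r → S) :
    Integrable (fun z => g (Function.update s q z)) ν :=
  Integrable.of_bound (hg.comp (measurable_update s)).aestronglyMeasurable M
    (Filter.Eventually.of_forall fun _ => hM _)

theorem integral_centerAt_self {g : (Fin r → S) → ℝ} (hg : Measurable g) {M : ℝ}
    (hM : ∀ s, |g s| ≤ M) (q : Fin r) (s : Fin r → S) :
    ∫ z, centerAt ν q g (Function.update s q z) ∂ν = 0 := by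
  simp only [centerAt, Function.update_idem]
  rw [integral_sub (integrable_update_of_bounded hg hM q s) (integrable_const _)]
  simp

theorem integral_centerAt_of_ne {g : (Fin r → S) → ℝ} (hg : Measurable g) {M : ℝ}
    (hM : ∀ s, |g s| ≤ M) {q p : Fin r} (hqp : q ≠ p)
    (hp : ∀ s, ∫ z, g (Function.update s p z) ∂ν = 0) (s : Fin r → S) :
    ∫ z, centerAt ν q g (Function.update s p z) ∂ν = 0 := by
  have hup : Measurable fun a : S × S => Function.update (Function.update s p a.1) q a.2 :=
    measurable_update'.comp (((measurable_update s).comp measurable_fst).prodMk measurable_snd)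
  have h2 : Integrable (fun a : S × S =>
      g (Function.update (Function.update s p a.1) q a.2)) (ν.prod ν) :=
    Integrable.of_bound (hg.comp hup).aestronglyMeasurable M
      (Filter.Eventually.of_forall fun _ => hM _)
  simp only [centerAt]
  rw [integral_sub (integrable_update_of_bounded hg hM p s) h2.integral_prod_left, hp,
    integral_integral_swap h2]
  simp only [Function.update_comm hqp.symm, hp]
  simp

theorem integral_centerList {g : (Fin r → S) → ℝ} (hg : Measurable g) {M : ℝ}
    (hM : ∀ s, |g s| ≤ M) {l : List (Fin r)} {q : Fin r} (hq : q ∈ l) (s : Fin r → S) :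
    ∫ z, centerList ν l g (Function.update s q z) ∂ν = 0 := by
  induction l generalizing s with
  | nil => simp at hq
  | cons p l ih =>
    by_cases hpq : p = q
    · subst hpq
      exact integral_centerAt_self (measurable_centerList l hg) (abs_centerList_le l hM) p s
    · exact integral_centerAt_of_ne (measurable_centerList l hg) (abs_centerList_le l hM) hpq
        (ih ((List.mem_cons.1 hq).resolve_left (Ne.symm hpq))) s

theorem isCompletelyDegenerate_centerList {g : (Fin r → S) → ℝ} (hg : Measurable g) {M : ℝ}
    (hM : ∀ s, |g s| ≤ M) :
    IsCompletelyDegenerate (centerList ν (List.finRange r) g) id ν := fun q s =>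
  ⟨integrable_update_of_bounded (measurable_centerList _ hg) (abs_centerList_le _ hM) q s,
    integral_centerList hg hM (List.mem_finRange q) s⟩

theorem enorm_integral_sq_le {F : S → ℝ} (hF : Measurable F) :
    ‖∫ z, F z ∂ν‖ₑ ^ 2 ≤ ∫⁻ z, ‖F z‖ₑ ^ 2 ∂ν := by
  have h1 := ENNReal.lintegral_mul_le_Lp_mul_Lq ν Real.HolderConjugate.two_two
    hF.enorm.aemeasurable (aemeasurable_const (b := (1 : ℝ≥0∞)))
  simp only [Pi.mul_apply, mul_one, ENNReal.one_rpow, lintegral_const, measure_univ] at h1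
  calc ‖∫ z, F z ∂ν‖ₑ ^ 2 ≤ (∫⁻ z, ‖F z‖ₑ ∂ν) ^ 2 := by
        gcongr; exact enorm_integral_le_lintegral_enorm _
    _ ≤ ((∫⁻ z, ‖F z‖ₑ ^ (2 : ℝ) ∂ν) ^ (1 / 2 : ℝ)) ^ 2 := by gcongr
    _ = ∫⁻ z, ‖F z‖ₑ ^ 2 ∂ν := by
        rw [← ENNReal.rpow_natCast, ← ENNReal.rpow_mul]
        norm_num

theorem enorm_sub_sq_le (a b : ℝ) : ‖a - b‖ₑ ^ 2 ≤ 2 * ‖a‖ₑ ^ 2 + 2 * ‖b‖ₑ ^ 2 := by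
  simp only [enorm_pow_eq_ofReal]
  rw [← ENNReal.ofReal_ofNat 2, ← ENNReal.ofReal_mul (by norm_num),
    ← ENNReal.ofReal_mul (by norm_num), ← ENNReal.ofReal_add (by positivity) (by positivity)]
  refine ENNReal.ofReal_le_ofReal ?_
  simp only [sq_abs]
  nlinarith [sq_nonneg (a + b)]

theorem lintegral_sub_centerAt_le {h g : (Fin r → S) → ℝ} (hh : Measurable h)
    (hd : IsCompletelyDegenerate h id ν) (hg : Measurable g) {M : ℝ} (hM : ∀ s, |g s| ≤ M)
    (q : Fin r) :
    ∫⁻ x, ‖h (head r x) - centerAt ν q g (head r x)‖ₑ ^ 2 ∂(Measure.infinitePi fun _ : ℕ => ν) ≤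
      4 * ∫⁻ x, ‖h (head r x) - g (head r x)‖ₑ ^ 2 ∂(Measure.infinitePi fun _ : ℕ => ν) := by
  have hF : Measurable fun s => h s - g s := hh.sub hg
  have hFx : Measurable fun x : ℕ → S => ‖h (head r x) - g (head r x)‖ₑ ^ 2 :=
    (hF.comp measurable_head).enorm.pow_const 2
  have hpt : ∀ x : ℕ → S, ‖h (head r x) - centerAt ν q g (head r x)‖ₑ ^ 2 ≤
      2 * ‖h (head r x) - g (head r x)‖ₑ ^ 2 +
        2 * ∫⁻ z, ‖h (head r (Function.update x q z)) -
          g (head r (Function.update x q z))‖ₑ ^ 2 ∂ν := by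
    intro x
    have e : h (head r x) - centerAt ν q g (head r x) = (h (head r x) - g (head r x)) -
        ∫ z, (h (Function.update (head r x) q z) - g (Function.update (head r x) q z)) ∂ν := by
      have h2 : ∫ z, h (Function.update (head r x) q z) ∂ν = 0 := (hd q (head r x)).2
      have h1 : Integrable (fun z => h (Function.update (head r x) q z)) ν := (hd q (head r x)).1
      rw [integral_sub h1 (integrable_update_of_bounded hg hM q _), h2, centerAt]
      ring
    rw [e]
    refine (enorm_sub_sq_le _ _).trans ?_
    simp only [head_update]
    gcongr
    exact enorm_integral_sq_le (hF.comp (measurable_update _))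
  refine (lintegral_mono hpt).trans (le_of_eq ?_)
  rw [lintegral_add_left (hFx.const_mul 2), lintegral_const_mul _ hFx,
    lintegral_const_mul' _ _ (by norm_num), ← lintegral_update ν (q : ℕ) hFx, ← add_mul]
  norm_num

theorem lintegral_sub_centerList_le {h g : (Fin r → S) → ℝ} (hh : Measurable h)
    (hd : IsCompletelyDegenerate h id ν) (hg : Measurable g) {M : ℝ} (hM : ∀ s, |g s| ≤ M)
    (l : List (Fin r)) :
    ∫⁻ x, ‖h (head r x) - centerList ν l g (head r x)‖ₑ ^ 2
        ∂(Measure.infinitePi fun _ : ℕ => ν) ≤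
      4 ^ l.length *
        ∫⁻ x, ‖h (head r x) - g (head r x)‖ₑ ^ 2 ∂(Measure.infinitePi fun _ : ℕ => ν) := by
  induction l with
  | nil => simp [centerList]
  | cons q l ih =>
    refine (lintegral_sub_centerAt_le hh hd (measurable_centerList l hg)
      (abs_centerList_le l hM) q).trans ?_
    rw [List.length_cons, pow_succ', mul_assoc]
    gcongr

end Centering

section Tails

theorem lintegral_sq_truncated_le {Ω : Type*} [MeasurableSpace Ω] (μ : Measure Ω) [SFinite μ]
    {H : Ω → ℝ} (hH : Measurable H) {κ : ℝ} (hκ : 0 < κ) :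
    ∫⁻ ω, ‖if |H ω| ≤ 2 * κ then 0 else H ω‖ₑ ^ 2 ∂μ ≤
      ENNReal.ofReal (2 * κ ^ 2) *
        ∫⁻ u in Set.Ioi (1 : ℝ), μ {ω | κ * Real.sqrt u < |H ω|} := by
  have hset : MeasurableSet {p : ℝ × Ω | κ * Real.sqrt p.1 < |H p.2|} :=
    measurableSet_lt ((Real.continuous_sqrt.measurable.comp measurable_fst).const_mul κ)
      (hH.comp measurable_snd).abs
  have e : ∫⁻ u in Set.Ioi (1 : ℝ), μ {ω | κ * Real.sqrt u < |H ω|} =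
      ∫⁻ ω, (∫⁻ u in Set.Ioi (1 : ℝ),
        {p : ℝ × Ω | κ * Real.sqrt p.1 < |H p.2|}.indicator 1 (u, ω)) ∂μ := by
    rw [← lintegral_lintegral_swap
      (f := fun u ω => {p : ℝ × Ω | κ * Real.sqrt p.1 < |H p.2|}.indicator 1 (u, ω))
      (measurable_one.indicator hset).aemeasurable]
    refine lintegral_congr fun u => ?_
    have hs : MeasurableSet {ω | κ * Real.sqrt u < |H ω|} :=
      measurableSet_lt measurable_const hH.abs
    rw [← lintegral_indicator_one hs]
    rfl
  rw [e, ← lintegral_const_mul' _ _ ENNReal.ofReal_ne_top]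
  refine lintegral_mono fun ω => ?_
  split_ifs with hle
  · simp
  · push Not at hle
    have hHκ : 2 * κ ^ 2 ≤ H ω ^ 2 := by
      rw [← sq_abs (H ω)]; nlinarith
    have hvol : ENNReal.ofReal (H ω ^ 2 / κ ^ 2 - 1) ≤ ∫⁻ u in Set.Ioi (1 : ℝ),
        {p : ℝ × Ω | κ * Real.sqrt p.1 < |H p.2|}.indicator 1 (u, ω) := by
      rw [← Real.volume_Ioo, ← lintegral_indicator_one measurableSet_Ioo,
        ← lintegral_indicator measurableSet_Ioi]
      refine lintegral_mono fun u => ?_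
      by_cases hu : u ∈ Set.Ioo 1 (H ω ^ 2 / κ ^ 2)
      · have hmem : (u, ω) ∈ {p : ℝ × Ω | κ * Real.sqrt p.1 < |H p.2|} := by
          have h1 : κ ^ 2 * u < H ω ^ 2 := by
            have := (lt_div_iff₀ (by positivity)).1 hu.2
            linarith
          change κ * Real.sqrt u < |H ω|
          refine lt_of_pow_lt_pow_left₀ 2 (abs_nonneg _) ?_
          rw [mul_pow, Real.sq_sqrt (by linarith [hu.1]), sq_abs]
          exact h1
        rw [Set.indicator_of_mem hu, Set.indicator_of_mem (show u ∈ Set.Ioi (1 : ℝ) from hu.1),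
          Set.indicator_of_mem hmem]
        rfl
      · rw [Set.indicator_of_notMem hu]
        exact zero_le
    refine le_trans ?_ (mul_le_mul_right hvol _)
    rw [enorm_pow_eq_ofReal, ← ENNReal.ofReal_mul (by positivity), sq_abs]
    refine ENNReal.ofReal_le_ofReal ?_
    have : 2 * κ ^ 2 * (H ω ^ 2 / κ ^ 2 - 1) = 2 * H ω ^ 2 - 2 * κ ^ 2 := by
      field_simp
    linarith

theorem measure_coordU_sub_ge_le {S : Type*} [MeasurableSpace S] {r : ℕ} (ν : Measure S)
    [IsProbabilityMeasure ν] {m : ℕ} (hm : 1 ≤ m) {h : (Fin (r + 1) → S) → ℝ}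
    (hh : Measurable h) (hd : IsCompletelyDegenerate h id ν) {n₁ n₂ : ℕ} (hn : n₁ < n₂)
    {w T : ℝ} (hw : w ^ 2 = ((n₂ - n₁ : ℕ) : ℝ) * n₂ ^ r) (hw0 : 0 < w) (hT : 0 < T) :
    (Measure.infinitePi fun _ : ℕ => ν) {x | T * w ≤ |coordU h n₂ x - coordU h n₁ x|} ≤
      ENNReal.ofReal (((64 * m) ^ (r + 1) / T ^ 2) ^ m) *
        ∫⁻ x, ‖h (head (r + 1) x)‖ₑ ^ (2 * m) ∂(Measure.infinitePi fun _ : ℕ => ν) := by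
  set P := Measure.infinitePi fun _ : ℕ => ν
  have hpos : 0 < (T * w) ^ (2 * m) := by positivity
  have hmeas : Measurable fun x => ‖coordU h n₂ x - coordU h n₁ x‖ₑ ^ (2 * m) :=
    ((measurable_coordU hh n₂).sub (measurable_coordU hh n₁)).enorm.pow_const _
  calc P {x | T * w ≤ |coordU h n₂ x - coordU h n₁ x|}
      ≤ P {x | ENNReal.ofReal ((T * w) ^ (2 * m)) ≤
          ‖coordU h n₂ x - coordU h n₁ x‖ₑ ^ (2 * m)} := by
        refine measure_mono fun x hx => ?_
        simp only [Set.mem_ofPred_eq] at hx ⊢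
        rw [enorm_pow_eq_ofReal]
        exact ENNReal.ofReal_le_ofReal (by gcongr)
    _ ≤ (∫⁻ x, ‖coordU h n₂ x - coordU h n₁ x‖ₑ ^ (2 * m) ∂P) /
          ENNReal.ofReal ((T * w) ^ (2 * m)) :=
        meas_ge_le_lintegral_div hmeas.aemeasurable (ENNReal.ofReal_pos.2 hpos).ne'
          ENNReal.ofReal_ne_top
    _ ≤ (((64 * m * (n₂ - n₁) : ℕ) : ℝ≥0∞) ^ m * (((64 * m * n₂ : ℕ) : ℝ≥0∞) ^ (r * m) *
          ∫⁻ x, ‖h (head (r + 1) x)‖ₑ ^ (2 * m) ∂P)) / ENNReal.ofReal ((T * w) ^ (2 * m)) :=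
        ENNReal.div_le_div_right (lintegral_coordU_sub_le ν hm hh hd hn.le) _
    _ = _ := by
        rw [← mul_assoc, ENNReal.mul_div_right_comm]
        congr 1
        rw [← ENNReal.ofReal_natCast, ← ENNReal.ofReal_natCast,
          ← ENNReal.ofReal_pow (by positivity), ← ENNReal.ofReal_pow (by positivity),
          ← ENNReal.ofReal_mul (by positivity), ← ENNReal.ofReal_div_of_pos hpos]
        congr 1
        rw [pow_mul (T * w) 2 m, mul_pow T w, hw, pow_mul, ← mul_pow, ← div_pow]
        congr 1
        have hn2 : (0 : ℝ) < n₂ := by exact_mod_cast (Nat.zero_le _).trans_lt hn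
        have hsub : (0 : ℝ) < (n₂ - n₁ : ℕ) := by exact_mod_cast Nat.sub_pos_of_lt hn
        rw [Nat.cast_mul, Nat.cast_mul (64 * m) n₂]
        push_cast
        field_simp
        ring

end Tails

theorem exists_moment_exponent {N : ℕ} (hN : 1 ≤ N) {t : ℝ} (ht : (3 : ℝ) ^ N < t) :
    ∃ m : ℕ, 1 ≤ m ∧ (m : ℝ) ^ N ≤ t ^ 2 ∧ t ^ (2 / (N : ℝ)) / 2 ≤ m := by
  have ht0 : 0 < t := lt_trans (by positivity) ht
  have hN0 : (N : ℝ) ≠ 0 := by positivity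
  set τ := t ^ (2 / (N : ℝ)) with hτ
  have hτ0 : 0 ≤ τ := by positivity
  have hτN : τ ^ N = t ^ 2 := by
    rw [hτ, ← Real.rpow_natCast, ← Real.rpow_mul ht0.le, div_mul_cancel₀ _ hN0]
    norm_num
  have hτ9 : 9 < τ := by
    refine lt_of_pow_lt_pow_left₀ N hτ0 ?_
    rw [hτN, show (9 : ℝ) = 3 ^ 2 by norm_num, ← pow_mul, mul_comm, pow_mul]
    gcongr
  refine ⟨⌈τ / 2⌉₊, Nat.one_le_iff_ne_zero.2 (Nat.ceil_pos.2 (by linarith)).ne', ?_,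
    Nat.le_ceil _⟩
  rw [← hτN]
  have := (Nat.ceil_lt_add_one (by linarith : 0 ≤ τ / 2)).le
  gcongr
  linarith

theorem bounded_tail_le {N m : ℕ} {x y : ℝ} (hx : 0 < x) (hy : 0 < y)
    (hmt : (m : ℝ) ^ N ≤ (x / y) ^ 2) (hm : (x / y) ^ (2 / (N : ℝ)) / 2 ≤ m) :
    ((64 * m) ^ N / (x / 2) ^ 2) ^ m * (2 ^ N * (2 * (1 / (8 * 128 ^ N) * y))) ^ (2 * m) ≤
      Real.exp (-(1 / 2) * (x / y) ^ (2 / (N : ℝ))) := by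
  have e : (64 * m : ℝ) ^ N / (x / 2) ^ 2 * (2 ^ N * (2 * (1 / (8 * 128 ^ N) * y))) ^ 2 =
      1 / 4 * (1 / 64) ^ N * (m ^ N / (x / y) ^ 2) := by
    have h1 : (128 : ℝ) ^ N = 64 ^ N * 2 ^ N := by rw [← mul_pow]; norm_num
    rw [h1, mul_pow (64 : ℝ), one_div_pow]
    field_simp
    ring
  have hle : (64 * m : ℝ) ^ N / (x / 2) ^ 2 * (2 ^ N * (2 * (1 / (8 * 128 ^ N) * y))) ^ 2 ≤
      Real.exp (-1) := by
    rw [e]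
    have h1 : (1 / 64 : ℝ) ^ N ≤ 1 := pow_le_one₀ (by norm_num) (by norm_num)
    have h2 : (m : ℝ) ^ N / (x / y) ^ 2 ≤ 1 := div_le_one_of_le₀ hmt (by positivity)
    have h3 : (1 / 4 : ℝ) ≤ Real.exp (-1) := by
      rw [Real.exp_neg, ← one_div]
      exact one_div_le_one_div_of_le (Real.exp_pos 1) (by linarith [Real.exp_one_lt_d9])
    calc (1 / 4 : ℝ) * (1 / 64) ^ N * (m ^ N / (x / y) ^ 2) ≤ 1 / 4 * 1 * 1 := by gcongr
      _ ≤ _ := by linarith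
  rw [pow_mul _ 2 m, ← mul_pow]
  calc _ ≤ Real.exp (-1) ^ m := by gcongr
    _ = Real.exp (-(m : ℝ)) := by rw [← Real.exp_nat_mul]; ring_nf
    _ ≤ _ := Real.exp_le_exp.2 (by linarith)

/-- The tail inequality for the coordinate process. -/
theorem measure_coordU_sub_gt_le {S : Type*} [MeasurableSpace S] {r : ℕ} (ν : Measure S)
    [IsProbabilityMeasure ν] {h : (Fin (r + 1) → S) → ℝ} (hh : Measurable h)
    (hd : IsCompletelyDegenerate h id ν) {x y : ℝ} (hx : 0 < x)
    (hxy : (3 : ℝ) ^ (r + 1) < x / y) {n₁ n₂ : ℕ} (hn : n₁ < n₂)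
    {w : ℝ} (hw : w ^ 2 = ((n₂ - n₁ : ℕ) : ℝ) * n₂ ^ r) (hw0 : 0 < w) :
    (Measure.infinitePi fun _ : ℕ => ν) {a | x * w < |coordU h n₂ a - coordU h n₁ a|} ≤
      ENNReal.ofReal (Real.exp (-(1 / 2) * (x / y) ^ (2 / ((r + 1 : ℕ) : ℝ)))) +
        ENNReal.ofReal (8 * 256 ^ (r + 1)) * ∫⁻ u in Set.Ioi (1 : ℝ),
          (Measure.infinitePi fun _ : ℕ => ν)
            {a | 1 / (8 * 128 ^ (r + 1)) * y * Real.sqrt u < |h (head (r + 1) a)|} := by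
  have hy : 0 < y := by
    by_contra hy
    have := div_nonpos_of_nonneg_of_nonpos hx.le (not_lt.1 hy)
    have h3 : (0 : ℝ) < 3 ^ (r + 1) := by positivity
    linarith
  have hyx : y ≤ x := by
    have h3 : (1 : ℝ) ≤ 3 ^ (r + 1) := one_le_pow₀ (by norm_num)
    exact ((one_lt_div hy).1 (h3.trans_lt hxy)).le
  set P := Measure.infinitePi fun _ : ℕ => ν
  obtain ⟨m, hm1, hmt, hm⟩ := exists_moment_exponent (Nat.succ_pos r) hxy
  set κ := 1 / (8 * 128 ^ (r + 1)) * y with hκdef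
  have hκ : 0 < κ := by positivity
  set g : (Fin (r + 1) → S) → ℝ := fun s => if |h s| ≤ 2 * κ then h s else 0 with hg
  have hgm : Measurable g :=
    Measurable.ite (measurableSet_le hh.abs measurable_const) hh measurable_const
  have hgb : ∀ s, |g s| ≤ 2 * κ := fun s => by
    simp only [hg]
    split_ifs with hs
    · exact hs
    · rw [abs_zero]; positivity
  set g' := centerList ν (List.finRange (r + 1)) g
  have hg'm : Measurable g' := measurable_centerList _ hgm
  have hg'd : IsCompletelyDegenerate g' id ν := isCompletelyDegenerate_centerList hgm hgb
  have hg'b : ∀ s, |g' s| ≤ 2 ^ (r + 1) * (2 * κ) := fun s => by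
    simpa using abs_centerList_le (ν := ν) (List.finRange (r + 1)) hgb s
  have hfm : Measurable fun s => h s - g' s := hh.sub hg'm
  have hx2 : 0 < x / 2 := by positivity
  have hT1 := measure_coordU_sub_ge_le ν hm1 hg'm hg'd hn hw hw0 hx2
  have hT2 := measure_coordU_sub_ge_le ν le_rfl hfm (hd.sub hg'd) hn hw hw0 hx2
  have hsub : {a | x * w < |coordU h n₂ a - coordU h n₁ a|} ⊆
      {a | x / 2 * w ≤ |coordU g' n₂ a - coordU g' n₁ a|} ∪
      {a | x / 2 * w ≤ |coordU (fun s => h s - g' s) n₂ a -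
        coordU (fun s => h s - g' s) n₁ a|} := by
    intro a ha
    by_contra hcon
    simp only [Set.mem_union, Set.mem_ofPred_eq, not_or, not_le, coordU_of_sub] at hcon ha
    have := abs_add_le (coordU g' n₂ a - coordU g' n₁ a)
      (coordU h n₂ a - coordU g' n₂ a - (coordU h n₁ a - coordU g' n₁ a))
    rw [show coordU g' n₂ a - coordU g' n₁ a +
      (coordU h n₂ a - coordU g' n₂ a - (coordU h n₁ a - coordU g' n₁ a)) =
      coordU h n₂ a - coordU h n₁ a by ring] at this
    linarith [hcon.1, hcon.2]
  refine (measure_mono hsub).trans ((measure_union_le _ _).trans (add_le_add ?_ ?_))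
  · refine hT1.trans ?_
    have hint : ∫⁻ a, ‖g' (head (r + 1) a)‖ₑ ^ (2 * m) ∂P ≤
        ENNReal.ofReal ((2 ^ (r + 1) * (2 * κ)) ^ (2 * m)) := by
      refine (lintegral_mono (g := fun _ => ENNReal.ofReal ((2 ^ (r + 1) * (2 * κ)) ^ (2 * m)))
        fun a => ?_).trans (by simp)
      rw [enorm_pow_eq_ofReal]
      refine ENNReal.ofReal_le_ofReal ?_
      gcongr
      exact hg'b _
    refine (mul_le_mul_right hint _).trans ?_
    rw [← ENNReal.ofReal_mul (by positivity)]
    exact ENNReal.ofReal_le_ofReal (bounded_tail_le hx hy hmt hm)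
  · refine hT2.trans ?_
    have h1 := lintegral_sub_centerList_le hh hd hgm hgb (List.finRange (r + 1))
    have h2 : ∫⁻ a, ‖h (head (r + 1) a) - g (head (r + 1) a)‖ₑ ^ 2 ∂P ≤ ENNReal.ofReal (2 * κ ^ 2) *
        ∫⁻ u in Set.Ioi (1 : ℝ), P {a | κ * Real.sqrt u < |h (head (r + 1) a)|} := by
      refine le_trans (lintegral_mono fun a => ?_)
        (lintegral_sq_truncated_le P (hh.comp measurable_head) hκ)
      refine le_of_eq ?_
      congr 2
      simp only [hg, Function.comp]
      split_ifs <;> simp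
    rw [mul_one, pow_one]
    refine (mul_le_mul_right (h1.trans (mul_le_mul_right h2 _)) _).trans ?_
    rw [List.length_finRange, ← mul_assoc, ← mul_assoc,
      show (4 : ℝ≥0∞) ^ (r + 1) = ENNReal.ofReal (4 ^ (r + 1)) by
        rw [ENNReal.ofReal_pow (by norm_num)]; norm_num,
      ← ENNReal.ofReal_mul (by positivity), ← ENNReal.ofReal_mul (by positivity)]
    refine mul_le_mul_left (ENNReal.ofReal_le_ofReal ?_) _
    have hκy : κ ≤ x := by
      refine le_trans (mul_le_of_le_one_left hy.le ?_) hyx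
      have : (1 : ℝ) ≤ 128 ^ (r + 1) := one_le_pow₀ (by norm_num)
      exact div_le_one_of_le₀ (by linarith) (by positivity)
    calc (64 * ((1 : ℕ) : ℝ)) ^ (r + 1) / (x / 2) ^ 2 * 4 ^ (r + 1) * (2 * κ ^ 2)
        = 8 * (64 ^ (r + 1) * 4 ^ (r + 1)) * (κ ^ 2 / x ^ 2) := by
          push_cast; field_simp; ring
      _ ≤ 8 * (64 ^ (r + 1) * 4 ^ (r + 1)) * 1 := by
          gcongr
          exact div_le_one_of_le₀ (by gcongr) (by positivity)
      _ = _ := by rw [← mul_pow]; norm_num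

end UStatistic

theorem mainTheorem6 (r : ℕ) (hr : 1 ≤ r) :
    ∃ A B C : ℝ, 0 < A ∧ 0 < B ∧ 0 < C ∧
      ∀ (Ω : Type*) [MeasurableSpace Ω] (μ : Measure Ω) [IsProbabilityMeasure μ]
        (S : Type*) [MeasurableSpace S]
        (h : (Fin r → S) → ℝ) (_ : Measurable h)
        (X : ℕ → Ω → S) (_ : ∀ i, Measurable (X i)) (_ : iIndepFun X μ)
        (_ : ∀ i, IdentDistrib (X i) (X 0) μ μ)
        (_ : UStatistic.IsCompletelyDegenerate h (X 0) μ)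
        (x y : ℝ) (_ : 0 < x) (_ : (3 : ℝ) ^ r < x / y)
        (n₁ n₂ : ℕ) (_ : r ≤ n₁) (_ : n₁ < n₂),
        μ {ω | x < 1 / (Real.sqrt ((n₂ : ℝ) - (n₁ : ℝ)) * (n₂ : ℝ) ^ (((r : ℝ) - 1) / 2)) *
              |UStatistic.U h X n₂ ω - UStatistic.U h X n₁ ω|} ≤
          ENNReal.ofReal (A * Real.exp (-(1 / 2) * (x / y) ^ (2 / (r : ℝ)))) +
            ENNReal.ofReal B *
              ∫⁻ u in Set.Ioi (1 : ℝ),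
                μ {ω | y * Real.sqrt u * C < |h fun k : Fin r => X k ω|} *
                  ENNReal.ofReal ((1 + Real.log u) ^ ((r : ℝ) * ((r : ℝ) - 1) / 2)) := by
  obtain ⟨r, rfl⟩ : ∃ k, r = k + 1 := ⟨r - 1, by omega⟩
  refine ⟨1, 8 * 256 ^ (r + 1), 1 / (8 * 128 ^ (r + 1)), one_pos, by positivity, by positivity,
    ?_⟩
  intro Ω _ μ _ S _ h hh X hX hind hid hdeg x y hx hxy n₁ n₂ hrn hn
  have hν : IsProbabilityMeasure (μ.map (X 0)) :=
    Measure.isProbabilityMeasure_map (hX 0).aemeasurable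
  have hXm : Measurable fun ω i => X i ω := measurable_pi_iff.2 hX
  have hlaw : μ.map (fun ω i => X i ω) = Measure.infinitePi fun _ : ℕ => μ.map (X 0) := by
    rw [hind.map_fun_eq_infinitePi_map hX]
    congr 1
    funext i
    exact (hid i).map_eq
  have hd : UStatistic.IsCompletelyDegenerate h id (μ.map (X 0)) := by
    intro q s
    have hm : Measurable fun z => h (Function.update s q z) := hh.comp (measurable_update s)
    constructor
    · exact (integrable_map_measure hm.aestronglyMeasurable (hX 0).aemeasurable).2 (hdeg q s).1
    · exact (integral_map (hX 0).aemeasurable hm.aestronglyMeasurable).trans (hdeg q s).2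
  have hsub : (0 : ℝ) < (n₂ : ℝ) - n₁ := sub_pos.2 (by exact_mod_cast hn)
  have hn2 : (0 : ℝ) < n₂ := by exact_mod_cast (Nat.zero_le _).trans_lt hn
  set w := Real.sqrt ((n₂ : ℝ) - (n₁ : ℝ)) * (n₂ : ℝ) ^ ((((r + 1 : ℕ) : ℝ) - 1) / 2) with hwdef
  have hw0 : 0 < w := by positivity
  have hw : w ^ 2 = ((n₂ - n₁ : ℕ) : ℝ) * n₂ ^ r := by
    rw [hwdef, mul_pow, Real.sq_sqrt hsub.le, Nat.cast_sub hn.le, ← Real.rpow_mul_natCast hn2.le,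
      ← Real.rpow_natCast]
    congr 2
    push_cast
    ring
  have key := UStatistic.measure_coordU_sub_gt_le (μ.map (X 0)) hh hd hx hxy hn hw hw0
  simp only [← hlaw] at key
  have hUm : Measurable fun a : ℕ → S => |UStatistic.coordU h n₂ a - UStatistic.coordU h n₁ a| :=
    ((UStatistic.measurable_coordU hh n₂).sub (UStatistic.measurable_coordU hh n₁)).abs
  have hhm : Measurable fun a : ℕ → S => |h (UStatistic.head (r + 1) a)| :=
    (hh.comp UStatistic.measurable_head).abs
  rw [Measure.map_apply hXm (measurableSet_lt measurable_const hUm)] at key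
  rw [one_mul]
  refine le_trans (measure_mono fun ω hω => ?_) (key.trans ?_)
  · change x < 1 / w * _ at hω
    rw [one_div, inv_mul_eq_div, lt_div_iff₀ hw0] at hω
    exact hω
  · refine add_le_add le_rfl (mul_le_mul_right ?_ _)
    refine setLIntegral_mono' (measurableSet_Ioi (a := (1 : ℝ))) fun u hu => ?_
    have hset : MeasurableSet {a : ℕ → S | 1 / (8 * 128 ^ (r + 1)) * y * Real.sqrt u <
        |h (UStatistic.head (r + 1) a)|} := measurableSet_lt measurable_const hhm
    rw [Measure.map_apply hXm hset]
    have h1 : (1 : ENNReal) ≤ ENNReal.ofReal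
        ((1 + Real.log u) ^ (((r + 1 : ℕ) : ℝ) * (((r + 1 : ℕ) : ℝ) - 1) / 2)) := by
      rw [ENNReal.one_le_ofReal]
      refine Real.one_le_rpow (by linarith [Real.log_nonneg (Set.mem_Ioi.1 hu).le]) ?_
      push_cast
      rw [add_sub_cancel_right]
      positivity
    refine le_trans (le_of_eq ?_) (le_mul_of_one_le_right' h1)
    congr 1
    ext ω
    change (_ : ℝ) < _ ↔ (_ : ℝ) < _
    rw [show 1 / (8 * 128 ^ (r + 1)) * y * Real.sqrt u =
      y * Real.sqrt u * (1 / (8 * 128 ^ (r + 1))) by ring]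
    rfl
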